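/- Let $\mathfrak A$ be a (not necessarily unital) $C^*$-algebra, let $H$ be a Hilbert $\mathfrak A$-module, and let $\mathcal L(H)$ be the $C^*$-algebra of adjointable operators on $H$, with unit $I$. For a projection $P=P^*=P^2\in\mathcal L(H)$ write $\mathcal R(P)$ for its range. Let $P,Q\in\mathcal L(H)$ be projections such that $(P,Q,H)$ is a matched triple, that is, $\mathcal R:=\mathcal R(P)\cap\mathcal R(Q)$ is orthogonally complemented in $H$: $H=\mathcal R+\mathcal R^\perp$, where $\mathcal R^\perp=\{x\in H:\langle x,y\rangle=0\ \text{for all } y\in\mathcal R\}$. Let $P\wedge Q\in\mathcal L(H)$ denote the projection with range $\mathcal R$. Let the inner algebra $i(P,Q,H)$ be the $C^*$-subalgebra of $\mathcal L(H)$ generated by $\{P-P\wedge Q,\ Q-P\wedge Q,\ I\}$, and the outer algebra $o(P,Q,H)$ the $C^*$-subalgebra of $\mathcal L(H)$ generated by $\{P,\ Q,\ P\wedge Q,\ I\}$. A representation $(\pi,X)$ of a $C^*$-algebra $\mathfrak B$ is a Hilbert space $X$ together with a (not necessarily unital) $*$-homomorphism $\pi:\mathfrak B\to\mathbb B(X)$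 into the bounded linear operators on $X$; it is faithful if $\pi$ is injective. Then for every faithful representation $(\pi,X)$ of $o(P,Q,H)$ there is a faithful representation $(\widetilde\pi,X)$ of $i(P,Q,H)$ on the same Hilbert space such that $$\widetilde\pi(I)=\pi(I),\qquad \widetilde\pi(P-P\wedge Q)=\pi(P)-\pi(P)\wedge\pi(Q),\qquad \widetilde\pi(Q-P\wedge Q)=\pi(Q)-\pi(P)\wedge\pi(Q),$$ where $\pi(P)\wedge\pi(Q)\in\mathbb B(X)$ is the orthogonal projection of $X$ onto $\mathcal R(\pi(P))\cap\mathcal R(\pi(Q))$. -/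

import Mathlib

namespace HilbertModule

noncomputable section

section Adjointable

variable (A : Type*) {H : Type*} [NonUnitalCStarAlgebra A] [PartialOrder A]
  [NormedAddCommGroup H] [NormedSpace ℂ H] [SMul A H] [CStarModule A H]

variable {A} in
theorem ext_inner {y z : H} (h : ∀ x : H, inner A x y = inner A x z) : y = z := by
  rw [← sub_eq_zero, ← CStarModule.inner_self (A := A), CStarModule.inner_sub_right, h, sub_self]

variable {A} in
/-- `S` is an adjoint of `T`: `⟨T x, y⟩ = ⟨x, S y⟩` for all `x`, `y`. -/
def IsAdjointOf (S T : H →L[ℂ] H) : Prop :=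
  ∀ x y : H, inner A (T x) y = inner A x (S y)

variable {A} in
theorem IsAdjointOf.symm {S T : H →L[ℂ] H} (h : IsAdjointOf (A := A) S T) :
    IsAdjointOf (A := A) T S := fun x y => by
  rw [← CStarModule.star_inner, ← h, CStarModule.star_inner]

variable {A} in
theorem IsAdjointOf.unique {S S' T : H →L[ℂ] H} (h : IsAdjointOf (A := A) S T)
    (h' : IsAdjointOf (A := A) S' T) : S = S' :=
  ContinuousLinearMap.ext fun y => ext_inner (A := A) fun x => by rw [← h, ← h']

variable (H) in
/-- The bounded operators on `H` that have an adjoint, as an algebra of operators. -/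
def adjointableSubalgebra : Subalgebra ℂ (H →L[ℂ] H) where
  carrier := {T | ∃ S : H →L[ℂ] H, IsAdjointOf (A := A) S T}
  mul_mem' := by
    rintro T T' ⟨S, hS⟩ ⟨S', hS'⟩
    exact ⟨S' * S, fun x y => by simp [hS _ _, hS' _ _]⟩
  add_mem' := by
    rintro T T' ⟨S, hS⟩ ⟨S', hS'⟩
    exact ⟨S + S', fun x y => by simp [hS _ _, hS' _ _]⟩
  algebraMap_mem' c := ⟨star c • 1, fun x y => by
    simp [Algebra.algebraMap_eq_smul_one]⟩

variable (H) in
/-- The algebra `ℒ(H)` of adjointable operators on a Hilbert `A`-module `H`, with the operator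
norm. (Adjointable maps and their adjoints are automatically `ℂ`-linear and bounded.) -/
def Adjointable : Type _ := adjointableSubalgebra A H

variable {A}

namespace Adjointable

instance : NormedRing (Adjointable A H) := inferInstanceAs (NormedRing (adjointableSubalgebra A H))

instance : NormedAlgebra ℂ (Adjointable A H) :=
  inferInstanceAs (NormedAlgebra ℂ (adjointableSubalgebra A H))

/-- The bounded operator underlying an element of `ℒ(H)`. -/
def toCLM : Adjointable A H →ₐ[ℂ] (H →L[ℂ] H) := (adjointableSubalgebra A H).val

theorem toCLM_injective : Function.Injective (toCLM : Adjointable A H → (H →L[ℂ] H)) :=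
  Subtype.val_injective

theorem norm_toCLM (T : Adjointable A H) : ‖toCLM T‖ = ‖T‖ := rfl

theorem exists_adjoint (T : Adjointable A H) :
    ∃ S : Adjointable A H, IsAdjointOf (A := A) (toCLM S) (toCLM T) :=
  ⟨⟨T.2.choose, T.1, T.2.choose_spec.symm⟩, T.2.choose_spec⟩

/-- The adjoint operator. -/
instance : Star (Adjointable A H) where
  star T := T.exists_adjoint.choose

theorem isAdjointOf_star (T : Adjointable A H) :
    IsAdjointOf (A := A) (toCLM (star T)) (toCLM T) := T.exists_adjoint.choose_spec

theorem star_eq {T S : Adjointable A H} (h : IsAdjointOf (A := A) (toCLM S) (toCLM T)) :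
    star T = S := toCLM_injective (T.isAdjointOf_star.unique h)

instance : StarRing (Adjointable A H) where
  star_involutive T := star_eq T.isAdjointOf_star.symm
  star_mul T S := star_eq fun x y => by
    simp [T.isAdjointOf_star _ _, S.isAdjointOf_star _ _]
  star_add T S := star_eq fun x y => by
    simp [T.isAdjointOf_star _ _, S.isAdjointOf_star _ _]

instance : StarModule ℂ (Adjointable A H) where
  star_smul c T := star_eq fun x y => by
    simp [T.isAdjointOf_star _ _]

variable [StarOrderedRing A]

instance : CStarRing (Adjointable A H) where
  norm_mul_self_le T := by
    have key : ‖toCLM T‖ ≤ √‖star T * T‖ := by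
      refine ContinuousLinearMap.opNorm_le_bound _ (Real.sqrt_nonneg _) fun x => ?_
      refine le_of_sq_le_sq ?_ (by positivity)
      rw [mul_pow, Real.sq_sqrt (norm_nonneg _), CStarModule.norm_sq_eq A,
        T.isAdjointOf_star]
      calc ‖inner A x (toCLM (star T) (toCLM T x))‖ ≤ ‖x‖ * ‖toCLM (star T * T) x‖ := by
            rw [map_mul]; exact CStarModule.norm_inner_le H
        _ ≤ ‖x‖ * (‖star T * T‖ * ‖x‖) := by
            gcongr; exact (toCLM (star T * T)).le_opNorm x
        _ = _ := by ring
    calc ‖T‖ * ‖T‖ ≤ √‖star T * T‖ * √‖star T * T‖ := by gcongr <;> exact key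
      _ = _ := Real.mul_self_sqrt (norm_nonneg _)

instance [CompleteSpace H] : CompleteSpace (Adjointable A H) := by
  have hcl : IsClosed (adjointableSubalgebra A H : Set (H →L[ℂ] H)) := by
    refine isClosed_of_closure_subset fun T hT => ?_
    obtain ⟨u, hu, hlim⟩ := mem_closure_iff_seq_limit.1 hT
    let v : ℕ → Adjointable A H := fun n => ⟨u n, hu n⟩
    have hv : CauchySeq fun n => toCLM (star (v n)) := by
      rw [Metric.cauchySeq_iff]
      intro ε hε
      obtain ⟨N, hN⟩ := Metric.cauchySeq_iff.1 hlim.cauchySeq ε hε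
      refine ⟨N, fun m hm n hn => ?_⟩
      rw [dist_eq_norm, ← map_sub, ← star_sub, norm_toCLM, norm_star, ← norm_toCLM, map_sub,
        ← dist_eq_norm]
      exact hN m hm n hn
    obtain ⟨S, hS⟩ := cauchySeq_tendsto_of_complete hv
    refine ⟨S, fun x y => ?_⟩
    have e1 : Filter.Tendsto (fun n => u n x) Filter.atTop (nhds (T x)) :=
      ((ContinuousLinearMap.apply ℂ H x).continuous.tendsto T).comp hlim
    have e2 : Filter.Tendsto (fun n => toCLM (star (v n)) y) Filter.atTop (nhds (S y)) :=
      ((ContinuousLinearMap.apply ℂ H y).continuous.tendsto S).comp hS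
    have h1 := ((CStarModule.continuous_inner (A := A) (E := H)).tendsto (T x, y)).comp
      (e1.prodMk_nhds tendsto_const_nhds)
    have h2 := ((CStarModule.continuous_inner (A := A) (E := H)).tendsto (x, S y)).comp
      (tendsto_const_nhds.prodMk_nhds e2)
    refine tendsto_nhds_unique h1 (h2.congr fun n => ?_)
    exact ((v n).isAdjointOf_star x y).symm
  exact hcl.completeSpace_coe

instance [CompleteSpace H] : CStarAlgebra (Adjointable A H) where

/-- The range of an adjointable operator. -/
def range (T : Adjointable A H) : Submodule ℂ H := LinearMap.range (toCLM T).toLinearMap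

end Adjointable

variable (A) in
/-- The orthogonal complement `M^⊥ = {x | ⟨x, y⟩ = 0 for all y ∈ M}`. -/
def orthCompl (M : Submodule ℂ H) : Submodule ℂ H where
  carrier := {x | ∀ y ∈ M, inner A x y = 0}
  add_mem' hx hx' y hy := by simp [hx y hy, hx' y hy]
  zero_mem' y _ := by simp
  smul_mem' c x hx y hy := by simp [hx y hy]

variable (A) in
/-- `M` is orthogonally complemented in `H`: `H = M + M^⊥`. -/
def IsOrthComplemented (M : Submodule ℂ H) : Prop := M ⊔ orthCompl A M = ⊤

variable [StarOrderedRing A]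

theorem IsOrthComplemented.exists_projection {M : Submodule ℂ H} (hM : IsOrthComplemented A M) :
    ∃ R : Adjointable A H, IsStarProjection R ∧ R.range = M := by
  have hc : IsCompl M (orthCompl A M) := by
    refine ⟨Submodule.disjoint_def.2 fun x hx hx' => ?_, codisjoint_iff.2 hM⟩
    exact (CStarModule.inner_self (A := A)).1 (hx' x hx)
  let f : H →ₗ[ℂ] H := M.projection (orthCompl A M) hc
  have hfM (x : H) : f x ∈ M := Submodule.projection_apply_mem hc x
  have hfN (x : H) : x - f x ∈ orthCompl A M := by
    have h := Submodule.projection_add_projection_eq_self hc x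
    have : x - f x = (orthCompl A M).projection M hc.symm x := by
      rw [sub_eq_iff_eq_add']; exact h.symm
    rw [this]
    exact Submodule.projection_apply_mem hc.symm x
  have h1 (x y : H) : inner A (f x) y = inner A (f x) (f y) := by
    have h := hfN y _ (hfM x)
    rw [← sub_eq_zero, ← CStarModule.inner_sub_right, ← CStarModule.star_inner, h, star_zero]
  have h2 (x y : H) : inner A x (f y) = inner A (f x) (f y) := by
    have h := hfN x _ (hfM y)
    rwa [CStarModule.inner_sub_left, sub_eq_zero] at h
  let F : H →L[ℂ] H := f.mkContinuous 1 fun x => by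
    rw [one_mul]
    by_cases h0 : ‖f x‖ = 0
    · rw [h0]; exact norm_nonneg x
    · have : ‖f x‖ * ‖f x‖ ≤ ‖f x‖ * ‖x‖ := by
        rw [← sq, CStarModule.norm_sq_eq A, ← h1]
        exact CStarModule.norm_inner_le H
      exact le_of_mul_le_mul_left this (lt_of_le_of_ne (norm_nonneg _) (Ne.symm h0))
  have hF : IsAdjointOf (A := A) F F := fun x y => (h1 x y).trans (h2 x y).symm
  have hid (x : H) (hx : x ∈ M) : f x = x := Submodule.projection_apply_of_mem_left hc hx
  refine ⟨⟨F, F, hF⟩, ⟨?_, Adjointable.star_eq hF⟩, ?_⟩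
  · exact Adjointable.toCLM_injective (ContinuousLinearMap.ext fun x => hid _ (hfM x))
  · ext x
    constructor
    · rintro ⟨y, rfl⟩
      exact hfM y
    · exact fun hx => ⟨x, hid x hx⟩

/-- The projection `P_M` in `ℒ(H)` with range an orthogonally complemented `M`. -/
def orthProj (M : Submodule ℂ H) (hM : IsOrthComplemented A M) : Adjointable A H :=
  hM.exists_projection.choose

theorem isStarProjection_orthProj {M : Submodule ℂ H} (hM : IsOrthComplemented A M) :
    IsStarProjection (orthProj M hM) := hM.exists_projection.choose_spec.1

theorem range_orthProj {M : Submodule ℂ H} (hM : IsOrthComplemented A M) :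
    (orthProj M hM).range = M := hM.exists_projection.choose_spec.2

/-- A projection in `ℒ(H)` is determined by its range, so `orthProj` is well defined. -/
theorem projection_ext {R S : Adjointable A H} (hR : IsStarProjection R) (hS : IsStarProjection S)
    (h : R.range = S.range) : R = S := by
  have aux {U V : Adjointable A H} (hU : IsStarProjection U) (hUV : V.range ≤ U.range) :
      U * V = V := by
    refine Adjointable.toCLM_injective (ContinuousLinearMap.ext fun x => ?_)
    obtain ⟨y, hy⟩ := hUV ⟨x, rfl⟩
    have e : Adjointable.toCLM U (Adjointable.toCLM U y) = Adjointable.toCLM U y := congrArg (fun W : Adjointable A H => Adjointable.toCLM W y) hU.1.eq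
    change Adjointable.toCLM U y = Adjointable.toCLM V x at hy
    change Adjointable.toCLM U (Adjointable.toCLM V x) = Adjointable.toCLM V x
    rw [← hy, e]
  have h1 : S * R = R := aux hS h.le
  have h2 := congrArg star (aux hR h.ge)
  rw [star_mul, hR.2.star_eq, hS.2.star_eq] at h2
  exact h1.symm.trans h2

end Adjointable

section Matched

variable {A H : Type*} [NonUnitalCStarAlgebra A] [PartialOrder A] [StarOrderedRing A]
  [NormedAddCommGroup H] [NormedSpace ℂ H] [SMul A H] [CStarModule A H]

/-- `(P, Q, H)` is a matched triple: `P`, `Q` are projections in `ℒ(H)` such that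
`ℛ(P) ∩ ℛ(Q)` is orthogonally complemented in `H`. -/
structure IsMatched (P Q : Adjointable A H) : Prop where
  left : IsStarProjection P
  right : IsStarProjection Q
  complemented : IsOrthComplemented A (P.range ⊓ Q.range)

variable {P Q : Adjointable A H}

/-- The infimum `P ∧ Q` of a matched triple: the projection onto `ℛ(P) ∩ ℛ(Q)`. -/
def IsMatched.inf (h : IsMatched P Q) : Adjointable A H := orthProj _ h.complemented

/-- The inner algebra `i(P, Q, H)`: the (norm-closed) `C^*`-subalgebra of `ℒ(H)` generated by
`P - P ∧ Q`, `Q - P ∧ Q` and `I`. -/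
def IsMatched.innerAlgebra (h : IsMatched P Q) : StarSubalgebra ℂ (Adjointable A H) :=
  (StarAlgebra.adjoin ℂ {P - h.inf, Q - h.inf, 1}).topologicalClosure

/-- The outer algebra `o(P, Q, H)`: the (norm-closed) `C^*`-subalgebra of `ℒ(H)` generated by
`P`, `Q`, `P ∧ Q` and `I`. -/
def IsMatched.outerAlgebra (h : IsMatched P Q) : StarSubalgebra ℂ (Adjointable A H) :=
  (StarAlgebra.adjoin ℂ {P, Q, h.inf, 1}).topologicalClosure

/-- `P - P ∧ Q` as an element of the inner algebra. -/
def IsMatched.innerLeft (h : IsMatched P Q) : h.innerAlgebra :=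
  ⟨P - h.inf, StarSubalgebra.le_topologicalClosure _ (StarAlgebra.subset_adjoin ℂ _ (by simp))⟩

/-- `Q - P ∧ Q` as an element of the inner algebra. -/
def IsMatched.innerRight (h : IsMatched P Q) : h.innerAlgebra :=
  ⟨Q - h.inf, StarSubalgebra.le_topologicalClosure _ (StarAlgebra.subset_adjoin ℂ _ (by simp))⟩

/-- `P` as an element of the outer algebra. -/
def IsMatched.outerLeft (h : IsMatched P Q) : h.outerAlgebra :=
  ⟨P, StarSubalgebra.le_topologicalClosure _ (StarAlgebra.subset_adjoin ℂ _ (by simp))⟩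

/-- `Q` as an element of the outer algebra. -/
def IsMatched.outerRight (h : IsMatched P Q) : h.outerAlgebra :=
  ⟨Q, StarSubalgebra.le_topologicalClosure _ (StarAlgebra.subset_adjoin ℂ _ (by simp))⟩

theorem IsMatched.isStarProjection_outerLeft (h : IsMatched P Q) :
    IsStarProjection h.outerLeft :=
  ⟨Subtype.ext h.left.1, Subtype.ext h.left.2⟩

theorem IsMatched.isStarProjection_outerRight (h : IsMatched P Q) :
    IsStarProjection h.outerRight :=
  ⟨Subtype.ext h.right.1, Subtype.ext h.right.2⟩

end Matched

section Hilbert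

variable {X : Type*} [NormedAddCommGroup X] [InnerProductSpace ℂ X] [CompleteSpace X]

theorem hasOrthogonalProjection_inf {p q : X →L[ℂ] X} (hp : IsStarProjection p)
    (hq : IsStarProjection q) :
    (LinearMap.range p.toLinearMap ⊓ LinearMap.range q.toLinearMap).HasOrthogonalProjection := by
  have hcl : IsClosed ((LinearMap.range p.toLinearMap ⊓ LinearMap.range q.toLinearMap :
      Submodule ℂ X) : Set X) :=
    (ContinuousLinearMap.IsIdempotentElem.isClosed_range hp.1).inter
      (ContinuousLinearMap.IsIdempotentElem.isClosed_range hq.1)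
  have := hcl.completeSpace_coe
  infer_instance

/-- The infimum `p ∧ q` of two projections on a Hilbert space: the orthogonal projection onto
`ℛ(p) ∩ ℛ(q)`. -/
def hilbertInf (p q : X →L[ℂ] X) (hp : IsStarProjection p) (hq : IsStarProjection q) :
    X →L[ℂ] X :=
  haveI := hasOrthogonalProjection_inf hp hq
  (LinearMap.range p.toLinearMap ⊓ LinearMap.range q.toLinearMap).starProjection

end Hilbert

end

end HilbertModule

/-! Write `R = P ∧ Q`, `p = π(P)`, `q = π(Q)`, `r = π(R)`, `s = p ∧ q`. Always `r ≤ s`, but equality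
may fail, and then the restriction `ρ` of `π` to the inner algebra is wrong by the projection `t = s
- r`: both generators `P - R`, `Q - R` act as the identity on the range of `t`, where they should
act as zero. That range is reducing and the inner algebra acts on it by scalars, so the cure is to
replace `ρ` there by a character `χ` that kills both generators.

Such a `χ` exists as soon as `(P - R) + (Q - R)` is not invertible (`exists_character`). If it were
invertible, `2 - (P - R) - (Q - R)` would have a left inverse, since no nonzero element is fixed by
both generators (`exists_leftInverse_two_sub`, `IsMatched.eq_zero_of_mul_eq`); but its image under
`ρ` annihilates `t`, forcing `t = 0`, in which case `ρ` itself works. Faithfulness survives the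
replacement because `t` is not in the image of `ρ`: a preimage would be fixed by both generators,
hence zero. -/

namespace HilbertModule

/-! ### Two projections in a `C⋆`-algebra: invertibility of the sum and characters. -/

section CStar

variable {B : Type*} [CStarAlgebra B]

/-- The parallelogram identity gives `1 = |aP + cQ|² ≤ 2(|aP|² + |cQ|²)`, and `|aP|² ≤ ‖a⋆a‖ P`, so
`P + Q` is bounded below by a positive scalar. In other words, two projections generate the whole
algebra as a left ideal only if their sum is invertible. -/
theorem isUnit_add_of_one_eq {P Q a c : B} (hP : IsStarProjection P) (hQ : IsStarProjection Q)
    (h : 1 = a * P + c * Q) : IsUnit (P + Q) := by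
  let _ := CStarAlgebra.spectralOrder B
  have := CStarAlgebra.spectralOrderedRing B
  have key {R : B} (hR : IsStarProjection R) (b : B) :
      star (b * R) * (b * R) ≤ ‖star b * b‖ • R := by
    have := CStarAlgebra.star_left_conjugate_le_norm_smul (a := R) (b := star b * b)
    rw [hR.2.star_eq, hR.1.eq] at this
    simpa only [star_mul, hR.2.star_eq, mul_assoc] using this
  -- One constant dominating both norms; the `+ 1` keeps it positive, so that `2 * K` can be
  -- inverted.
  set K : ℝ := ‖star a * a‖ + ‖star c * c‖ + 1 with hK
  have hK0 : 0 < K := by positivity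
  have h1 : (1 : B) ≤ (2 * K) • (P + Q) := by
    have e1 : star (a * P) * (a * P) ≤ K • P :=
      (key hP a).trans (smul_le_smul_of_nonneg_right (by rw [hK]; linarith [norm_nonneg (star c * c)])
        hP.nonneg)
    have e2 : star (c * Q) * (c * Q) ≤ K • Q :=
      (key hQ c).trans (smul_le_smul_of_nonneg_right (by rw [hK]; linarith [norm_nonneg (star a * a)])
        hQ.nonneg)
    have e3 := star_mul_self_nonneg (a * P - c * Q)
    have e4 : (1 : B) = star (a * P + c * Q) * (a * P + c * Q) := by rw [← h]; simp
    have e5 : (1 : B) + star (a * P - c * Q) * (a * P - c * Q) =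
        (2 : ℝ) • (star (a * P) * (a * P) + star (c * Q) * (c * Q)) := by
      rw [e4, star_add, star_sub]
      simp only [add_mul, mul_add, sub_mul, mul_sub, two_smul]
      abel
    calc (1 : B) ≤ 1 + star (a * P - c * Q) * (a * P - c * Q) := le_add_of_nonneg_right e3
      _ = (2 : ℝ) • (star (a * P) * (a * P) + star (c * Q) * (c * Q)) := e5
      _ ≤ (2 : ℝ) • (K • P + K • Q) := smul_le_smul_of_nonneg_left (add_le_add e1 e2) zero_le_two
      _ = (2 * K) • (P + Q) := by rw [← smul_add, smul_smul]
  have h2 := CStarAlgebra.isUnit_of_le 1 h1 ⟨zero_le_one, isUnit_one⟩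
  have h3 : P + Q = ((2 * K)⁻¹ : ℝ) • ((2 * K) • (P + Q)) := by
    rw [smul_smul, inv_mul_cancel₀ (by positivity), one_smul]
  rw [h3]
  exact h2.smul (Units.mk0 ((2 * K)⁻¹ : ℝ) (by positivity))

/-- If `P + Q` is invertible, then `2 - (P + Q)` is von Neumann regular; so it has a left inverse as
soon as no nonzero element is fixed by both `P` and `Q`. -/
theorem exists_leftInverse_two_sub {B : Type*} [Ring B] {P Q : B} (hP : P * P = P)
    (hQ : Q * Q = Q) (hu : IsUnit (P + Q)) (hz : ∀ z : B, P * z = z → Q * z = z → z = 0) :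
    ∃ G : B, G * (2 - (P + Q)) = 1 := by
  obtain ⟨u, hu⟩ := hu
  set D := P - Q
  set C := 2 - (P + Q)
  have hDB : D * u = C * D := by
    rw [hu]; simp only [D, C]
    simp only [sub_mul, mul_sub, add_mul, mul_add, two_mul, hP, hQ]; abel
  have hBD : u * D = D * C := by
    rw [hu]; simp only [D, C]
    simp only [sub_mul, mul_sub, add_mul, mul_add, mul_two, hP, hQ]; abel
  have hDD : D * D = u * C := by
    rw [hu]; simp only [D, C]
    simp only [sub_mul, mul_sub, add_mul, mul_add, mul_two, hP, hQ]; abel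
  have hBC : u * C = C * u := by
    rw [hu]; simp only [C]
    simp only [sub_mul, mul_sub, mul_two, two_mul]
  have hD1 : D = C * D * ↑u⁻¹ := by rw [← hDB]; simp
  have hD2 : D = ↑u⁻¹ * (D * C) := by rw [← hBD]; simp
  have hC' : C = ↑u⁻¹ * (D * D) := by rw [hDD]; simp
  have hCi : ↑u⁻¹ * C = C * ↑u⁻¹ := by
    rw [Units.inv_mul_eq_iff_eq_mul, ← mul_assoc, hBC]; simp
  -- Substituting `D = C D u⁻¹` and `D = u⁻¹ D C` for the two factors of `C = u⁻¹ D D`, and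
  -- commuting `u⁻¹` past `C`, gives `C = C G C` with this `G`.
  let G := ↑u⁻¹ * (D * ↑u⁻¹ * (↑u⁻¹ * D))
  have hG : C * (G * C) = C := by
    calc C * (G * C) = (C * ↑u⁻¹) * (D * ↑u⁻¹ * (↑u⁻¹ * (D * C))) := by simp only [G, mul_assoc]
      _ = ↑u⁻¹ * ((C * D * ↑u⁻¹) * (↑u⁻¹ * (D * C))) := by rw [← hCi]; simp only [mul_assoc]
      _ = C := by rw [← hD1, ← hD2, ← hC']
  have hCz : C * (1 - G * C) = 0 := by rw [mul_sub, mul_one, hG, sub_self]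
  generalize hzdef : 1 - G * C = z at hCz
  -- `C z = 0` says `(1 - P) z = -(1 - Q) z`. This element is killed by both `P` and `Q`, hence by
  -- the invertible `u`.
  have hw : (1 - P) * z = 0 := by
    have e : (1 - P) * z + (1 - Q) * z = 0 := by
      rw [← hCz]; simp only [C, sub_mul, add_mul, two_mul, one_mul]; abel
    have e1 : P * ((1 - P) * z) = 0 := by
      rw [← mul_assoc, mul_sub, hP, mul_one, sub_self, zero_mul]
    have e2 : Q * ((1 - P) * z) = 0 := by
      rw [eq_neg_of_add_eq_zero_left e, mul_neg, ← mul_assoc, mul_sub, hQ, mul_one, sub_self,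
        zero_mul, neg_zero]
    have : ↑u * ((1 - P) * z) = 0 := by rw [hu, add_mul, e1, e2, add_zero]
    simpa using this
  have hw' : (1 - Q) * z = 0 := by
    have e : (1 - P) * z + (1 - Q) * z = 0 := by
      rw [← hCz]; simp only [C, sub_mul, add_mul, two_mul, one_mul]; abel
    rwa [hw, zero_add] at e
  rw [sub_mul, one_mul, sub_eq_zero] at hw hw'
  have := hz z hw.symm hw'.symm
  exact ⟨G, by rw [← hzdef, sub_eq_zero] at this; exact this.symm⟩

/-- A closed subspace of the `C⋆`-algebra generated by a set `s` of self-adjoint elements which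
contains the unit and is stable under left multiplication by `s` is everything. -/
theorem eq_top_of_mul_mem {s : Set B} (hs : ∀ x ∈ s, star x = x)
    {K : Submodule ℂ (StarAlgebra.adjoin ℂ s).topologicalClosure}
    (hK : IsClosed (K : Set (StarAlgebra.adjoin ℂ s).topologicalClosure)) (h1 : 1 ∈ K)
    (hmul : ∀ a : (StarAlgebra.adjoin ℂ s).topologicalClosure, (a : B) ∈ s → ∀ k ∈ K, a * k ∈ K) :
    K = ⊤ := by
  have hle := (StarAlgebra.adjoin ℂ s).le_topologicalClosure
  -- The claim covers `x` and `star x` together so that the induction passes through the `star`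
  -- case.
  have hadj (x : B) (hx : x ∈ StarAlgebra.adjoin ℂ s) :
      ∀ k ∈ K, (⟨x, hle hx⟩ : (StarAlgebra.adjoin ℂ s).topologicalClosure) * k ∈ K ∧
        star (⟨x, hle hx⟩ : (StarAlgebra.adjoin ℂ s).topologicalClosure) * k ∈ K := by
    induction hx using StarAlgebra.adjoin_induction with
    | mem x hx =>
      refine fun k hk => ⟨hmul _ hx k hk, hmul _ ?_ k hk⟩
      change star x ∈ s
      rwa [hs x hx]
    | algebraMap r =>
      intro k hk
      have e (r : ℂ) (hr) : (⟨algebraMap ℂ B r, hr⟩ : (StarAlgebra.adjoin ℂ s).topologicalClosure)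
          * k = r • k := Subtype.ext (by simp [Algebra.algebraMap_eq_smul_one])
      refine ⟨by rw [e]; exact K.smul_mem _ hk, ?_⟩
      have e' : star (⟨algebraMap ℂ B r, hle (algebraMap_mem _ r)⟩ :
          (StarAlgebra.adjoin ℂ s).topologicalClosure) * k = star r • k :=
        Subtype.ext (by simp [Algebra.algebraMap_eq_smul_one])
      rw [e']; exact K.smul_mem _ hk
    | add x y hx hy ihx ihy =>
      refine fun k hk => ⟨?_, ?_⟩
      · have := K.add_mem (ihx k hk).1 (ihy k hk).1
        rwa [← add_mul] at this
      · have := K.add_mem (ihx k hk).2 (ihy k hk).2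
        rwa [← add_mul, ← star_add] at this
    | mul x y hx hy ihx ihy =>
      refine fun k hk => ⟨?_, ?_⟩
      · have := (ihx _ (ihy k hk).1).1
        rwa [← mul_assoc] at this
      · have := (ihy _ (ihx k hk).2).2
        rwa [← mul_assoc, ← star_mul] at this
    | star x hx ih =>
      refine fun k hk => ⟨(ih k hk).2, ?_⟩
      have := (ih k hk).1
      rwa [← star_star (⟨x, hle hx⟩ : (StarAlgebra.adjoin ℂ s).topologicalClosure)] at this
  rw [eq_top_iff]
  intro a _
  have ha : (a : B) ∈ closure (StarAlgebra.adjoin ℂ s : Set B) := a.2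
  obtain ⟨v, hv, hlim⟩ := mem_closure_iff_seq_limit.1 ha
  refine hK.mem_of_tendsto (f := fun n => (⟨v n, hle (hv n)⟩ :
    (StarAlgebra.adjoin ℂ s).topologicalClosure)) (tendsto_subtype_rng.2 hlim)
    (Filter.Eventually.of_forall fun n => ?_)
  simpa using (hadj _ (hv n) 1 h1).1

/-- The closed left ideal `J` generated by `P` and `Q` is proper, and `J + ℂ1` is closed and stable
under left multiplication by `P` and `Q`. Hence `J` has codimension one, and `χ a` is the scalar
with `a - χ a • 1 ∈ J`. -/
theorem exists_character {B : Type*} [CStarAlgebra B] {P Q : B} (hP : IsStarProjection P)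
    (hQ : IsStarProjection Q) (hu : ¬ IsUnit (P + Q))
    (hgen : ∀ K : Submodule ℂ B, IsClosed (K : Set B) → 1 ∈ K → (∀ k ∈ K, P * k ∈ K) →
      (∀ k ∈ K, Q * k ∈ K) → K = ⊤) :
    ∃ χ : B →⋆ₐ[ℂ] ℂ, χ P = 0 ∧ χ Q = 0 := by
  have hne : Ideal.span {P, Q} ≠ ⊤ := by
    rw [Ideal.ne_top_iff_one, Ideal.mem_span_pair]
    rintro ⟨a, c, h⟩
    exact hu (isUnit_add_of_one_eq hP hQ h.symm)
  let J : Ideal B := (Ideal.span {P, Q}).closure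
  have hJ1 : (1 : B) ∉ J := (Ideal.ne_top_iff_one _).1 (Ideal.closure_ne_top _ hne)
  have hPJ : P ∈ J := subset_closure (Ideal.subset_span (by simp))
  have hQJ : Q ∈ J := subset_closure (Ideal.subset_span (by simp))
  have hJc : IsClosed ((J.restrictScalars ℂ : Submodule ℂ B) : Set B) := isClosed_closure
  have htop : J.restrictScalars ℂ ⊔ Submodule.span ℂ {1} = ⊤ := by
    have hmul (R : B) (hR : R ∈ J) (k : B) (hk : k ∈ J.restrictScalars ℂ ⊔ Submodule.span ℂ {1}) :
        R * k ∈ J.restrictScalars ℂ ⊔ Submodule.span ℂ {1} := by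
      obtain ⟨j, hj, m, hm, rfl⟩ := Submodule.mem_sup.1 hk
      obtain ⟨c, rfl⟩ := Submodule.mem_span_singleton.1 hm
      refine Submodule.mem_sup_left ?_
      rw [mul_add, mul_smul_comm, mul_one]
      exact add_mem (J.mul_mem_left R hj) ((J.restrictScalars ℂ).smul_mem c hR)
    exact hgen _ (Submodule.isClosed_sup_finiteDimensional _ _ hJc)
      (Submodule.mem_sup_right (Submodule.mem_span_singleton_self 1)) (hmul P hPJ) (hmul Q hQJ)
  have hex (a : B) : ∃ c : ℂ, a - c • 1 ∈ J := by
    obtain ⟨j, hj, m, hm, rfl⟩ := Submodule.mem_sup.1 (htop ▸ Submodule.mem_top : a ∈ _)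
    obtain ⟨c, rfl⟩ := Submodule.mem_span_singleton.1 hm
    exact ⟨c, by simpa using hj⟩
  choose f hf using hex
  have huniq (a : B) (c : ℂ) (hc : a - c • 1 ∈ J) : f a = c := by
    by_contra hne
    have h1 : (f a - c) • (1 : B) ∈ J.restrictScalars ℂ := by
      have := J.sub_mem hc (hf a)
      rw [sub_sub_sub_cancel_left, ← sub_smul] at this
      exact this
    have h2 := (J.restrictScalars ℂ).smul_mem (f a - c)⁻¹ h1
    rw [smul_smul, inv_mul_cancel₀ (sub_ne_zero.2 hne), one_smul] at h2
    exact hJ1 h2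
  let φ : B →ₐ[ℂ] ℂ :=
    { toFun := f
      map_one' := huniq _ _ (by simp)
      map_zero' := huniq _ _ (by simp)
      -- `ab - f(a)f(b) = a(b - f(b)) + f(b)(a - f(a))`, so a left ideal is enough.
      map_mul' := fun a b => huniq _ _ <| by
        have := add_mem (J.mul_mem_left a (hf b)) ((J.restrictScalars ℂ).smul_mem (f b) (hf a))
        convert this using 1
        simp only [mul_sub, smul_sub, mul_smul_comm, mul_one, smul_smul]
        rw [mul_comm (f b)]
        abel
      map_add' := fun a b => huniq _ _ <| by
        have := add_mem (hf a) (hf b)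
        rwa [sub_add_sub_comm, ← add_smul] at this
      commutes' := fun c => huniq _ _ (by simp [Algebra.algebraMap_eq_smul_one]) }
  have := AlgHomClass.instStarHomClass (F := B →ₐ[ℂ] ℂ) (A := B)
  exact ⟨{ φ with map_star' := fun a => map_star φ a }, huniq P 0 (by simpa using hPJ),
    huniq Q 0 (by simpa using hQJ)⟩

end CStar

/-- Modify a representation on a reducing subspace, replacing it there by a character. -/
theorem exists_replace_character {B E : Type*} [Ring B] [StarRing B] [Algebra ℂ B] [Ring E]
    [StarRing E] [Algebra ℂ E] [StarModule ℂ E] (ρ : B →⋆ₙₐ[ℂ] E) (χ : B →⋆ₐ[ℂ] ℂ) {t : E}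
    (ht : IsStarProjection t) (hcomm : ∀ a, ρ a * t = t * ρ a) :
    ∃ ρ' : B →⋆ₙₐ[ℂ] E, ∀ a, ρ' a = ρ a - ρ a * t + χ a • t := by
  have htt : t * t = t := ht.1
  refine ⟨{ toFun := fun a => ρ a - ρ a * t + χ a • t
            map_smul' := fun c a => ?_
            map_zero' := by simp
            map_add' := fun a b => ?_
            map_mul' := fun a b => ?_
            map_star' := fun a => ?_ }, fun a => rfl⟩
  · simp only [map_smul, smul_mul_assoc, smul_add, smul_sub, smul_smul, smul_eq_mul,
      MonoidHom.id_apply]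
  · simp only [map_add, add_mul, add_smul]; abel
  · have e1 : ρ a * t * ρ b = ρ a * ρ b * t := by rw [mul_assoc, ← hcomm, mul_assoc]
    have e2 : ρ a * t * (ρ b * t) = ρ a * ρ b * t := by rw [← mul_assoc, e1, mul_assoc, htt]
    have e3 : t * (ρ b * t) = ρ b * t := by rw [← mul_assoc, ← hcomm, mul_assoc, htt]
    have e4 : ρ a * t * t = ρ a * t := by rw [mul_assoc, htt]
    have e5 : t * ρ b = ρ b * t := (hcomm b).symm
    have e6 : ρ a * (ρ b * t) = ρ a * ρ b * t := (mul_assoc _ _ _).symm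
    simp only [map_mul, add_mul, mul_add, sub_mul, mul_sub, smul_mul_assoc, mul_smul_comm, e1, e2,
      e3, e4, e5, e6, htt]
    rw [mul_comm (χ a), mul_smul]
    abel_nf
  · simp only [map_star, star_add, star_sub, star_mul, star_smul, ht.2.star_eq]
    rw [← map_star, hcomm]

/-! ### The infimum of two projections on a Hilbert space. -/

section Hilbert

variable {X : Type*} [NormedAddCommGroup X] [InnerProductSpace ℂ X] [CompleteSpace X]
  {p q : X →L[ℂ] X} (hp : IsStarProjection p) (hq : IsStarProjection q)

theorem isStarProjection_hilbertInf : IsStarProjection (hilbertInf p q hp hq) := by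
  have := hasOrthogonalProjection_inf hp hq
  exact isStarProjection_starProjection

theorem hilbertInf_mul_of_mul_eq {r : X →L[ℂ] X} (h1 : p * r = r) (h2 : q * r = r) :
    hilbertInf p q hp hq * r = r := by
  have := hasOrthogonalProjection_inf hp hq
  ext x
  exact Submodule.starProjection_eq_self_iff.2
    ⟨⟨r x, congrArg (fun T : X →L[ℂ] X => T x) h1⟩, ⟨r x, congrArg (fun T : X →L[ℂ] X => T x) h2⟩⟩

theorem mul_hilbertInf : p * hilbertInf p q hp hq = hilbertInf p q hp hq := by
  have := hasOrthogonalProjection_inf hp hq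
  ext x
  obtain ⟨y, hy⟩ := ((LinearMap.range p.toLinearMap ⊓
    LinearMap.range q.toLinearMap).starProjection_apply_mem x).1
  change p (hilbertInf p q hp hq x) = hilbertInf p q hp hq x
  change p y = hilbertInf p q hp hq x at hy
  rw [← hy]
  exact congrArg (fun T : X →L[ℂ] X => T y) hp.1.eq

theorem mul_hilbertInf_right : q * hilbertInf p q hp hq = hilbertInf p q hp hq := by
  have := hasOrthogonalProjection_inf hp hq
  ext x
  obtain ⟨y, hy⟩ := ((LinearMap.range p.toLinearMap ⊓
    LinearMap.range q.toLinearMap).starProjection_apply_mem x).2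
  change q (hilbertInf p q hp hq x) = hilbertInf p q hp hq x
  change q y = hilbertInf p q hp hq x at hy
  rw [← hy]
  exact congrArg (fun T : X →L[ℂ] X => T y) hq.1.eq

end Hilbert

/-! ### Algebraic relations of `P ∧ Q` in a matched triple. -/

section Matched

variable {A H : Type*} [NonUnitalCStarAlgebra A] [PartialOrder A] [StarOrderedRing A]
  [NormedAddCommGroup H] [NormedSpace ℂ H] [SMul A H] [CStarModule A H]
  {P Q : Adjointable A H}

theorem Adjointable.mul_eq_of_range_le {U V : Adjointable A H} (hU : IsStarProjection U)
    (hUV : V.range ≤ U.range) : U * V = V := by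
  refine Adjointable.toCLM_injective (ContinuousLinearMap.ext fun x => ?_)
  obtain ⟨y, hy⟩ := hUV ⟨x, rfl⟩
  change Adjointable.toCLM U y = Adjointable.toCLM V x at hy
  change Adjointable.toCLM U (Adjointable.toCLM V x) = Adjointable.toCLM V x
  rw [← hy]
  exact congrArg (fun W : Adjointable A H => Adjointable.toCLM W y) hU.1.eq

theorem Adjointable.range_le_of_mul_eq {U V : Adjointable A H} (h : U * V = V) :
    V.range ≤ U.range := by
  rintro _ ⟨x, rfl⟩
  exact ⟨toCLM V x, congrArg (fun W : Adjointable A H => toCLM W x) h⟩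

namespace IsMatched

variable (h : IsMatched P Q)

theorem isStarProjection_inf : IsStarProjection h.inf := isStarProjection_orthProj _

theorem range_inf : h.inf.range = P.range ⊓ Q.range := range_orthProj _

theorem left_mul_inf : P * h.inf = h.inf :=
  Adjointable.mul_eq_of_range_le h.left (h.range_inf.le.trans inf_le_left)

theorem right_mul_inf : Q * h.inf = h.inf :=
  Adjointable.mul_eq_of_range_le h.right (h.range_inf.le.trans inf_le_right)

theorem inf_mul_left : h.inf * P = h.inf := by
  simpa [h.left.2.star_eq, h.isStarProjection_inf.2.star_eq] using congrArg star h.left_mul_inf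

theorem inf_mul_right : h.inf * Q = h.inf := by
  simpa [h.right.2.star_eq, h.isStarProjection_inf.2.star_eq] using congrArg star h.right_mul_inf

theorem inf_mul_of_mul_eq {z : Adjointable A H} (h1 : P * z = z) (h2 : Q * z = z) :
    h.inf * z = z :=
  Adjointable.mul_eq_of_range_le h.isStarProjection_inf (h.range_inf ▸
    le_inf (Adjointable.range_le_of_mul_eq h1) (Adjointable.range_le_of_mul_eq h2))

theorem isStarProjection_left_sub : IsStarProjection (P - h.inf) := by
  refine ⟨?_, h.left.2.sub h.isStarProjection_inf.2⟩
  change (P - h.inf) * (P - h.inf) = P - h.inf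
  rw [sub_mul, mul_sub, mul_sub, h.left.1.eq, h.left_mul_inf, h.inf_mul_left,
    h.isStarProjection_inf.1.eq]
  abel

theorem isStarProjection_right_sub : IsStarProjection (Q - h.inf) := by
  refine ⟨?_, h.right.2.sub h.isStarProjection_inf.2⟩
  change (Q - h.inf) * (Q - h.inf) = Q - h.inf
  rw [sub_mul, mul_sub, mul_sub, h.right.1.eq, h.right_mul_inf, h.inf_mul_right,
    h.isStarProjection_inf.1.eq]
  abel

theorem isStarProjection_innerLeft : IsStarProjection h.innerLeft :=
  ⟨Subtype.ext h.isStarProjection_left_sub.1, Subtype.ext h.isStarProjection_left_sub.2⟩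

theorem isStarProjection_innerRight : IsStarProjection h.innerRight :=
  ⟨Subtype.ext h.isStarProjection_right_sub.1, Subtype.ext h.isStarProjection_right_sub.2⟩

/-- Since `R(P - R) = 0` for `R = P ∧ Q`, such a `z` satisfies `R z = 0`, hence `P z = z = Q z`; its
range then lies in that of `R`, so `z = R z = 0`. -/
theorem eq_zero_of_mul_eq {z : Adjointable A H} (h1 : (P - h.inf) * z = z)
    (h2 : (Q - h.inf) * z = z) : z = 0 := by
  have hR : h.inf * z = 0 := by
    rw [← h1, ← mul_assoc, mul_sub, h.inf_mul_left, h.isStarProjection_inf.1.eq, sub_self,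
      zero_mul]
  rw [sub_mul, hR, sub_zero] at h1 h2
  rw [← h.inf_mul_of_mul_eq h1 h2, hR]

theorem innerAlgebra_le_outerAlgebra : h.innerAlgebra ≤ h.outerAlgebra := by
  refine StarSubalgebra.topologicalClosure_mono (StarAlgebra.adjoin_le ?_)
  have hP : P ∈ StarAlgebra.adjoin ℂ {P, Q, h.inf, 1} := StarAlgebra.subset_adjoin ℂ _ (by simp)
  have hQ : Q ∈ StarAlgebra.adjoin ℂ {P, Q, h.inf, 1} := StarAlgebra.subset_adjoin ℂ _ (by simp)
  have hR : h.inf ∈ StarAlgebra.adjoin ℂ {P, Q, h.inf, 1} :=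
    StarAlgebra.subset_adjoin ℂ _ (by simp)
  rintro x (rfl | rfl | rfl)
  exacts [sub_mem hP hR, sub_mem hQ hR, one_mem _]

/-- `P ∧ Q` as an element of the outer algebra. -/
noncomputable def outerInf : h.outerAlgebra :=
  ⟨h.inf, StarSubalgebra.le_topologicalClosure _ (StarAlgebra.subset_adjoin ℂ _ (by simp))⟩

theorem isStarProjection_outerInf : IsStarProjection h.outerInf :=
  ⟨Subtype.ext h.isStarProjection_inf.1, Subtype.ext h.isStarProjection_inf.2⟩

theorem innerAlgebra_eq_top [CompleteSpace H] {K : Submodule ℂ h.innerAlgebra}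
    (hK : IsClosed (K : Set h.innerAlgebra)) (h1 : 1 ∈ K) (hP : ∀ k ∈ K, h.innerLeft * k ∈ K)
    (hQ : ∀ k ∈ K, h.innerRight * k ∈ K) : K = ⊤ := by
  refine eq_top_of_mul_mem ?_ hK h1 ?_
  · rintro x (rfl | rfl | rfl)
    exacts [h.isStarProjection_left_sub.2, h.isStarProjection_right_sub.2, star_one _]
  · rintro ⟨a, ha⟩ (rfl | rfl | rfl) k hk
    exacts [hP k hk, hQ k hk, by simpa using (one_mul k).symm ▸ hk]

end IsMatched

end Matched

end HilbertModule

/-! ### Construction of the representation of the inner algebra. -/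

open HilbertModule in
theorem mainTheorem1 {A H X : Type*}
    [NonUnitalCStarAlgebra A] [PartialOrder A] [StarOrderedRing A]
    [NormedAddCommGroup H] [NormedSpace ℂ H] [CompleteSpace H] [SMul A H] [CStarModule A H]
    [NormedAddCommGroup X] [InnerProductSpace ℂ X] [CompleteSpace X]
    {P Q : HilbertModule.Adjointable A H} (h : HilbertModule.IsMatched P Q)
    (π : h.outerAlgebra →⋆ₙₐ[ℂ] (X →L[ℂ] X)) (hπ : Function.Injective π) :
    ∃ π' : h.innerAlgebra →⋆ₙₐ[ℂ] (X →L[ℂ] X),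
      Function.Injective π' ∧
      π' 1 = π 1 ∧
      π' h.innerLeft = π h.outerLeft -
        HilbertModule.hilbertInf (π h.outerLeft) (π h.outerRight)
          (h.isStarProjection_outerLeft.map π) (h.isStarProjection_outerRight.map π) ∧
      π' h.innerRight = π h.outerRight -
        HilbertModule.hilbertInf (π h.outerLeft) (π h.outerRight)
          (h.isStarProjection_outerLeft.map π) (h.isStarProjection_outerRight.map π) := by
  have : IsClosed (h.innerAlgebra : Set (Adjointable A H)) := isClosed_closure
  have hp := h.isStarProjection_outerLeft.map π
  have hq := h.isStarProjection_outerRight.map π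
  set p := π h.outerLeft with hpdef
  set q := π h.outerRight with hqdef
  set s := hilbertInf p q hp hq
  set r := π h.outerInf with hrdef
  have hs : IsStarProjection s := isStarProjection_hilbertInf hp hq
  have hr : IsStarProjection r :=
    h.isStarProjection_outerInf.map π
  have hps : p * s = s := mul_hilbertInf hp hq
  have hqs : q * s = s := mul_hilbertInf_right hp hq
  have hpr : p * r = r := by
    rw [hpdef, hrdef, ← map_mul]; exact congrArg π (Subtype.ext h.left_mul_inf)
  have hqr : q * r = r := by
    rw [hqdef, hrdef, ← map_mul]; exact congrArg π (Subtype.ext h.right_mul_inf)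
  have hsr : s * r = r := hilbertInf_mul_of_mul_eq hp hq hpr hqr
  have hrs : r * s = r := by
    simpa [hs.2.star_eq, hr.2.star_eq] using congrArg star hsr
  set t := s - r with htdef
  have ht : IsStarProjection t := by
    refine ⟨?_, hs.2.sub hr.2⟩
    change t * t = t
    rw [htdef, sub_mul, mul_sub, mul_sub, hs.1.eq, hsr, hrs, hr.1.eq]
    abel
  have hpt : p * t = t := by rw [htdef, mul_sub, hps, hpr]
  have hqt : q * t = t := by rw [htdef, mul_sub, hqs, hqr]
  have hrt : r * t = 0 := by rw [htdef, mul_sub, hrs, hr.1.eq, sub_self]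
  let ι := StarSubalgebra.inclusion h.innerAlgebra_le_outerAlgebra
  let ρ : h.innerAlgebra →⋆ₙₐ[ℂ] (X →L[ℂ] X) := π.comp (ι : h.innerAlgebra →⋆ₙₐ[ℂ] h.outerAlgebra)
  have hρinj : Function.Injective ρ :=
    hπ.comp (StarSubalgebra.inclusion_injective h.innerAlgebra_le_outerAlgebra)
  have hρ1 : ρ 1 = π 1 := rfl
  have hρP : ρ h.innerLeft = p - r := by
    rw [hpdef, hrdef, ← map_sub]; rfl
  have hρQ : ρ h.innerRight = q - r := by
    rw [hqdef, hrdef, ← map_sub]; rfl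
  have hρPt : ρ h.innerLeft * t = t := by rw [hρP, sub_mul, hpt, hrt, sub_zero]
  have hρQt : ρ h.innerRight * t = t := by rw [hρQ, sub_mul, hqt, hrt, sub_zero]
  have hρ1t : ρ 1 * t = t := by rw [← hρPt, ← mul_assoc, ← map_mul, one_mul]
  by_cases ht0 : t = 0
  · have hsr' : s = r := sub_eq_zero.1 ht0
    exact ⟨ρ, hρinj, hρ1, by rw [hρP, hsr'], by rw [hρQ, hsr']⟩
  have hnu : ¬ IsUnit (h.innerLeft + h.innerRight) := by
    intro hu
    obtain ⟨G, hG⟩ := exists_leftInverse_two_sub h.isStarProjection_innerLeft.1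
      h.isStarProjection_innerRight.1 hu fun z h1 h2 =>
        Subtype.ext (h.eq_zero_of_mul_eq (congrArg Subtype.val h1) (congrArg Subtype.val h2))
    have e : ρ (2 - (h.innerLeft + h.innerRight)) * t = 0 := by
      rw [← one_add_one_eq_two, map_sub, map_add, map_add, sub_mul, add_mul, add_mul, hρ1t, hρPt,
        hρQt, sub_self]
    apply ht0
    rw [← hρ1t, ← hG, map_mul, mul_assoc, e, mul_zero]
  obtain ⟨χ, hχP, hχQ⟩ := exists_character h.isStarProjection_innerLeft
    h.isStarProjection_innerRight hnu fun K hK h1 hP hQ => h.innerAlgebra_eq_top hK h1 hP hQ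
  -- The elements that act on `t` by a scalar form a closed subspace containing `1` and stable under
  -- left multiplication by the generators, both of which fix `t`.
  have hscal (a : h.innerAlgebra) : ∃ c : ℂ, ρ a * t = c • t := by
    have hcont : Continuous ρ := AddMonoidHomClass.continuous_of_bound ρ 1 fun a => by
      rw [one_mul]; exact NonUnitalStarAlgHom.norm_apply_le ρ a
    let f : h.innerAlgebra →ₗ[ℂ] (X →L[ℂ] X) :=
      { toFun := fun a => ρ a * t
        map_add' := fun a b => by rw [map_add, add_mul]
        map_smul' := fun c a => by rw [map_smul, smul_mul_assoc]; rfl }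
    have hf : Continuous f := hcont.mul continuous_const
    have htop := h.innerAlgebra_eq_top (K := (Submodule.span ℂ {t}).comap f)
      (by simpa using (Submodule.closed_of_finiteDimensional (Submodule.span ℂ {t})).preimage hf)
      (Submodule.mem_span_singleton.2 ⟨1, by rw [one_smul]; exact hρ1t.symm⟩)
      (fun k hk => by
        obtain ⟨c, hc⟩ := Submodule.mem_span_singleton.1 hk
        change c • t = ρ k * t at hc
        refine Submodule.mem_span_singleton.2 ⟨c, ?_⟩
        change c • t = ρ (h.innerLeft * k) * t
        rw [map_mul, mul_assoc, ← hc, mul_smul_comm, hρPt])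
      (fun k hk => by
        obtain ⟨c, hc⟩ := Submodule.mem_span_singleton.1 hk
        change c • t = ρ k * t at hc
        refine Submodule.mem_span_singleton.2 ⟨c, ?_⟩
        change c • t = ρ (h.innerRight * k) * t
        rw [map_mul, mul_assoc, ← hc, mul_smul_comm, hρQt])
    obtain ⟨c, hc⟩ := Submodule.mem_span_singleton.1 (Submodule.eq_top_iff'.1 htop a)
    exact ⟨c, hc.symm⟩
  -- Taking adjoints makes `t * ρ a` a multiple of `t` as well; compressing by `t` on both sides
  -- shows that the two scalar multiples agree.
  have hcomm (a : h.innerAlgebra) : ρ a * t = t * ρ a := by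
    obtain ⟨c, hc⟩ := hscal a
    obtain ⟨d, hd⟩ := hscal (star a)
    have hd' : t * ρ a = star d • t := by
      have := congrArg star hd
      rwa [star_mul, star_smul, ← map_star, star_star, ht.2.star_eq] at this
    have e1 : t * (ρ a * t) = c • t := by rw [hc, mul_smul_comm, ht.1.eq]
    have e2 : t * (ρ a * t) = star d • t := by rw [← mul_assoc, hd', smul_mul_assoc, ht.1.eq]
    rw [hc, hd', ← e1, e2]
  obtain ⟨ρ', hρ'⟩ := exists_replace_character ρ χ ht hcomm
  refine ⟨ρ', ?_, ?_, ?_, ?_⟩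
  · rw [injective_iff_map_eq_zero]
    intro a ha
    rw [hρ'] at ha
    obtain ⟨c, hc⟩ := hscal a
    -- Right multiplication by `t` isolates the character part, because `ρ a - ρ a * t` is killed by
    -- it.
    have hχ : χ a • t = 0 := by
      have := congrArg (· * t) ha
      simpa [add_mul, sub_mul, mul_assoc, ht.1.eq] using this
    rw [hχ, add_zero, sub_eq_zero, hc] at ha
    by_cases hc0 : c = 0
    · rw [hc0, zero_smul] at ha
      exact hρinj (ha.trans (map_zero ρ).symm)
    · exfalso
      -- Here `ρ a = c • t` with `c ≠ 0` would put `t` in the image of `ρ`.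
      have hz : ρ (c⁻¹ • a) = t := by rw [map_smul, ha, smul_smul, inv_mul_cancel₀ hc0, one_smul]
      have hPz : h.innerLeft * (c⁻¹ • a) = c⁻¹ • a := hρinj (by rw [map_mul, hz, hρPt])
      have hQz : h.innerRight * (c⁻¹ • a) = c⁻¹ • a := hρinj (by rw [map_mul, hz, hρQt])
      have hz0 : c⁻¹ • a = 0 :=
        Subtype.ext (h.eq_zero_of_mul_eq (congrArg Subtype.val hPz) (congrArg Subtype.val hQz))
      exact ht0 (by rw [← hz, hz0, map_zero])
  · rw [hρ', hρ1t, map_one χ, one_smul, sub_add_cancel, hρ1]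
  · rw [hρ', hχP, hρPt, hρP, zero_smul, add_zero, htdef]; abel
  · rw [hρ', hχQ, hρQt, hρQ, zero_smul, add_zero, htdef]; abel
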